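/- Let $k$ be an algebraically closed field and let $A$ be a basic connected finite dimensional $k$-algebra whose ordinary quiver $Q$ has no oriented cycles. Let $\nu\colon kQ\twoheadrightarrow A$ be a presentation of $A$ by quiver and admissible relations, that is, a surjective $k$-algebra homomorphism whose kernel $I=\mathrm{Ker}(\nu)$ satisfies $(kQ^+)^N\subseteq I\subseteq (kQ^+)^2$ for some $N\geqslant 2$, where $kQ^+$ is the ideal generated by the arrows. Paths are composed from right to left and $e_x\in A$ denotes the image under $\nu$ of the trivial path at the vertex $x$. Let $\sim_I$ be the smallest equivalence relation on the walks of $Q$ which is compatible with concatenation and satisfies $\alpha\alpha^{-1}\sim_I e_y$ and $\alpha^{-1}\alpha\sim_I e_x$ for every arrow $\alpha\colon x\to y$, and $u\sim_I v$ whenever the paths $u,v$ both appear with nonzero coefficients in a minimal relation of $I$ (a nonzero element of $I$ no nonempty proper subsum of which lies in $I$). Fix a vertex $x_0$ and a maximal tree $T$ of $Q$; let $\pi_1(Q,I)$ be the group of $\sim_I$-classes $[\gamma]_I$ of closed walks $\gamma$ at $x_0$, let $\gamma_x$ be the walk in $T$ of minimal length from $x_0$ to $x$, and view the space $\mathrm{Hom}(\pi_1(Q,I),k^+)$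 of group homomorphisms to the additive group of $k$ as an abelian Lie algebra. Let $\mathrm{Der}_0(A)$ be the Lie algebra of the $k$-linear derivations of $A$ vanishing on all $e_x$, and let $\mathrm{Int}_0(A)$ be its ideal of the derivations $a\mapsto ca-ac$ with $c\in\sum_x k\,e_x$. The first Hochschild cohomology $\mathrm{HH}^1(A)$ is the Lie algebra of all $k$-linear derivations of $A$ modulo the inner ones, and it is identified with $\mathrm{Der}_0(A)/\mathrm{Int}_0(A)$ by the map induced by $\mathrm{Der}_0(A)\subseteq \mathrm{Der}(A)$. Let $\theta_\nu\colon \mathrm{Hom}(\pi_1(Q,I),k^+)\to \mathrm{Der}_0(A)/\mathrm{Int}_0(A)$ be the Lie algebra homomorphism sending $f$ to the class of the derivation $\widetilde f$ such that $\widetilde f(\nu(u))=f([\gamma_y^{-1}u\gamma_x]_I)\,\nu(u)$ for every path $u$ from $x$ to $y$. Assume that $A$ is constricted, that is, $\dim_k e_yAe_x=1$ for every arrow $x\to y$ of $Q$. Then $\theta_\nu$ is an isomorphism of Lie algebras, and the canonical map $\mathrm{Der}_0(A)/\mathrm{Int}_0(A)\to\mathrm{HH}^1(A)$ is an isomorphism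 of Lie algebras, so that $\theta_\nu$ is an isomorphism $\mathrm{Hom}(\pi_1(Q,I),k^+)\xrightarrow{\sim}\mathrm{HH}^1(A)$. In particular, $\mathrm{HH}^1(A)$ is an abelian Lie algebra. -/

import Mathlib

universe u v w z

namespace BoundQuiver

open Quiver

/-! ### Path algebras -/

section PathAlgebra

/-- An oriented path of the quiver `V`, together with its source and its target. -/
@[ext]
structure OPath (V : Type u) [Quiver.{v} V] where
  src : V
  tgt : V
  path : Path src tgt

/-- The path algebra: the vector space with basis the set of oriented paths. -/
def PathAlgebra (k : Type w) [Field k] (V : Type u) [Quiver.{v} V] : Type (max u v w) :=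
  OPath V →₀ k

variable (k : Type w) [Field k] {V : Type u} [Quiver.{v} V]

noncomputable instance : AddCommGroup (PathAlgebra k V) :=
  inferInstanceAs (AddCommGroup (OPath V →₀ k))

noncomputable instance : Module k (PathAlgebra k V) :=
  inferInstanceAs (Module k (OPath V →₀ k))

/-- The basis element of the path algebra given by a path. -/
noncomputable def single (p : OPath V) : PathAlgebra k V := Finsupp.single p (1 : k)

/-- The basis element of the path algebra given by a path from `x` to `y`. -/
noncomputable def ofPath {x y : V} (p : Path x y) : PathAlgebra k V := single k ⟨x, y, p⟩

/-- The product `q p` of two paths, read from right to left: first `p`, then `q`; it is zero if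
the target of `p` is not the source of `q`. -/
noncomputable def pathMul (q p : OPath V) : PathAlgebra k V :=
  open Classical in
  if h : p.tgt = q.src then ofPath k (p.path.comp (q.path.cast h.symm rfl)) else 0

/-- The product of the path algebra, bilinearly extending the product of paths. -/
noncomputable def mulLin :
    PathAlgebra k V →ₗ[k] PathAlgebra k V →ₗ[k] PathAlgebra k V :=
  Finsupp.linearCombination k fun q : OPath V =>
    (Finsupp.linearCombination k fun p : OPath V => pathMul k q p :
      (OPath V →₀ k) →ₗ[k] PathAlgebra k V)

noncomputable instance : Mul (PathAlgebra k V) := ⟨fun a b => mulLin k a b⟩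

/-- The unit of the path algebra: the sum of the trivial paths. -/
noncomputable instance [Fintype V] : One (PathAlgebra k V) :=
  ⟨∑ x : V, ofPath k (Path.nil : Path x x)⟩

theorem mul_def (a b : PathAlgebra k V) : a * b = mulLin k a b := rfl

theorem one_def [Fintype V] :
    (1 : PathAlgebra k V) = ∑ x : V, ofPath k (Path.nil : Path x x) := rfl

theorem single_mul_single (q p : OPath V) : single k q * single k p = pathMul k q p := by
  rw [mul_def]
  unfold mulLin single
  erw [Finsupp.linearCombination_single, one_smul, Finsupp.linearCombination_single, one_smul]

theorem ofPath_mul_ofPath {x y t : V} (q : Path y t) (p : Path x y) :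
    ofPath k q * ofPath k p = ofPath k (p.comp q) := by
  unfold ofPath
  rw [single_mul_single]
  simp [pathMul, ofPath]

theorem ofPath_mul_ofPath_of_ne {x y y' t : V} (q : Path y' t) (p : Path x y) (h : y ≠ y') :
    ofPath k q * ofPath k p = 0 := by
  unfold ofPath
  rw [single_mul_single]
  simp [pathMul, h]

/-- Linear maps out of the path algebra are determined by their values on paths. -/
theorem span_ofPath :
    Submodule.span k {a : PathAlgebra k V | ∃ (x y : V) (p : Path x y), a = ofPath k p} = ⊤ := by
  rw [eq_top_iff]
  rintro a -
  induction a using Finsupp.induction_linear with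
  | zero => exact Submodule.zero_mem _
  | add f g hf hg => exact Submodule.add_mem _ hf hg
  | single p c =>
    have : (Finsupp.single p c : OPath V →₀ k) = c • (Finsupp.single p (1 : k)) := by simp
    rw [this]
    exact Submodule.smul_mem _ _ (Submodule.subset_span ⟨_, _, p.path, rfl⟩)

theorem path_induction {P : PathAlgebra k V → Prop}
    (zero : P 0) (add : ∀ a b, P a → P b → P (a + b)) (smul : ∀ (c : k) a, P a → P (c • a))
    (path : ∀ (x y : V) (p : Path x y), P (ofPath k p)) (a : PathAlgebra k V) : P a := by
  have h : a ∈ Submodule.span k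
      {a : PathAlgebra k V | ∃ (x y : V) (p : Path x y), a = ofPath k p} := by
    rw [span_ofPath]; trivial
  induction h using Submodule.span_induction with
  | mem a h => obtain ⟨x, y, p, rfl⟩ := h; exact path x y p
  | zero => exact zero
  | add a b _ _ h1 h2 => exact add _ _ h1 h2
  | smul c a _ h => exact smul _ _ h

theorem add_mul' (a b c : PathAlgebra k V) : (a + b) * c = a * c + b * c := by
  simp [mul_def]

theorem mul_add' (a b c : PathAlgebra k V) : a * (b + c) = a * b + a * c := by
  simp [mul_def]

theorem zero_mul' (a : PathAlgebra k V) : 0 * a = 0 := by simp [mul_def]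

theorem mul_zero' (a : PathAlgebra k V) : a * 0 = 0 := by simp [mul_def]

theorem smul_mul' (r : k) (a b : PathAlgebra k V) : (r • a) * b = r • (a * b) := by
  simp [mul_def]

theorem mul_smul' (r : k) (a b : PathAlgebra k V) : a * (r • b) = r • (a * b) := by
  simp [mul_def]

theorem mul_assoc' (a b c : PathAlgebra k V) : a * b * c = a * (b * c) := by
  induction a using path_induction with
  | zero => simp only [zero_mul']
  | add _ _ h1 h2 => simp only [add_mul', h1, h2]
  | smul _ _ h => simp only [smul_mul', h]
  | path x y p => ?_
  induction b using path_induction with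
  | zero => simp only [zero_mul', mul_zero']
  | add _ _ h1 h2 => simp only [add_mul', mul_add', h1, h2]
  | smul _ _ h => simp only [smul_mul', mul_smul', h]
  | path x' y' p' => ?_
  induction c using path_induction with
  | zero => simp only [mul_zero']
  | add _ _ h1 h2 => simp only [mul_add', h1, h2]
  | smul _ _ h => simp only [mul_smul', h]
  | path x'' y'' p'' => ?_
  by_cases h1 : y' = x
  · subst h1
    by_cases h2 : y'' = x'
    · subst h2
      simp [ofPath_mul_ofPath]
    · rw [ofPath_mul_ofPath, ofPath_mul_ofPath_of_ne _ _ _ h2,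
        ofPath_mul_ofPath_of_ne _ _ _ h2, mul_zero']
  · rw [ofPath_mul_ofPath_of_ne _ _ _ h1, zero_mul']
    by_cases h2 : y'' = x'
    · subst h2
      rw [ofPath_mul_ofPath, ofPath_mul_ofPath_of_ne _ _ _ h1]
    · rw [ofPath_mul_ofPath_of_ne _ _ _ h2, mul_zero']

theorem sum_mul' {ι : Type*} (s : Finset ι) (f : ι → PathAlgebra k V) (a : PathAlgebra k V) :
    (∑ i ∈ s, f i) * a = ∑ i ∈ s, f i * a := by
  simp [mul_def]

theorem mul_sum' {ι : Type*} (s : Finset ι) (f : ι → PathAlgebra k V) (a : PathAlgebra k V) :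
    a * (∑ i ∈ s, f i) = ∑ i ∈ s, a * f i := by
  simp [mul_def]

theorem one_mul' [Fintype V] (a : PathAlgebra k V) : 1 * a = a := by
  induction a using path_induction with
  | zero => simp only [mul_zero']
  | add _ _ h1 h2 => simp only [mul_add', h1, h2]
  | smul _ _ h => simp only [mul_smul', h]
  | path x y p => ?_
  rw [one_def, sum_mul', Finset.sum_eq_single y, ofPath_mul_ofPath, Path.comp_nil]
  · intro b _ hb
    exact ofPath_mul_ofPath_of_ne _ _ _ hb.symm
  · simp

theorem mul_one' [Fintype V] (a : PathAlgebra k V) : a * 1 = a := by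
  induction a using path_induction with
  | zero => simp only [zero_mul']
  | add _ _ h1 h2 => simp only [add_mul', h1, h2]
  | smul _ _ h => simp only [smul_mul', h]
  | path x y p => ?_
  rw [one_def, mul_sum', Finset.sum_eq_single x, ofPath_mul_ofPath, Path.nil_comp]
  · intro b _ hb
    exact ofPath_mul_ofPath_of_ne _ _ _ hb
  · simp

variable [Fintype V]

noncomputable instance : Ring (PathAlgebra k V) :=
  { (inferInstance : AddCommGroup (PathAlgebra k V)),
    (inferInstance : Mul (PathAlgebra k V)),
    (inferInstance : One (PathAlgebra k V)) with
    left_distrib := mul_add' k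
    right_distrib := add_mul' k
    zero_mul := zero_mul' k
    mul_zero := mul_zero' k
    mul_assoc := mul_assoc' k
    one_mul := one_mul' k
    mul_one := mul_one' k }

noncomputable instance : Algebra k (PathAlgebra k V) :=
  Algebra.ofModule (smul_mul' k) (mul_smul' k)

variable (V) in
/-- The two-sided ideal `kQ⁺` of the path algebra generated by the arrows. -/
noncomputable def arrowIdeal : Submodule k (PathAlgebra k V) :=
  ⊤ * Submodule.span k {a | ∃ (x y : V) (α : x ⟶ y), a = ofPath k α.toPath} * ⊤

variable {k}

/-- Admissibility of an ideal `I` (given as a subspace): `(kQ⁺)^N ⊆ I ⊆ (kQ⁺)^2` for some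
`N ≥ 2`. -/
def IsAdmissible (I : Submodule k (PathAlgebra k V)) : Prop :=
  ∃ N : ℕ, 2 ≤ N ∧ arrowIdeal k V ^ N ≤ I ∧ I ≤ arrowIdeal k V ^ 2

end PathAlgebra

/-! ### Walks, minimal relations, homotopy, fundamental groups -/

section Homotopy

variable {V : Type u} [Quiver.{v} V]

/-- A walk from `x` to `y`: an oriented path in the double quiver. -/
abbrev Walk (x y : Symmetrify V) := Path x y

/-- An oriented path, seen as a walk. -/
def toWalk {x y : V} (p : Path x y) : Walk x y := Symmetrify.of.mapPath p

variable {k : Type w} [Field k]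

/-- The coefficient of the path `p` in an element of the path algebra. -/
def coeff (r : PathAlgebra k V) (p : OPath V) : k := (show OPath V →₀ k from r) p

/-- The paths occurring in an element of the path algebra with a nonzero coefficient. -/
def supp (r : PathAlgebra k V) : Finset (OPath V) := Finsupp.support (show OPath V →₀ k from r)

/-- The subsum of an element of the path algebra on a finite set of paths. -/
noncomputable def subsum (r : PathAlgebra k V) (S : Finset (OPath V)) : PathAlgebra k V :=
  ∑ p ∈ S, coeff r p • single k p

theorem eq_subsum (r : PathAlgebra k V) : r = subsum r (supp r) := by
  have h := Finsupp.sum_single (show OPath V →₀ k from r)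
  rw [Finsupp.sum] at h
  refine h.symm.trans (Finset.sum_congr rfl fun p _ => ?_)
  unfold single coeff
  erw [Finsupp.smul_single, smul_eq_mul, mul_one]

theorem mem_supp (r : PathAlgebra k V) (p : OPath V) : p ∈ supp r ↔ coeff r p ≠ 0 :=
  Finsupp.mem_support_iff

/-- Minimal relations of `I`: nonzero elements of `I` no nonempty proper subsum of which
lies in `I`. -/
def IsMinimalRelation (I : Submodule k (PathAlgebra k V)) (r : PathAlgebra k V) : Prop :=
  r ∈ I ∧ r ≠ 0 ∧
    ∀ S : Finset (OPath V), S.Nonempty → S ⊂ supp r → subsum r S ∉ I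

/-- The homotopy relation on walks defined by `I`. -/
inductive Homotopic (I : Submodule k (PathAlgebra k V)) :
    ∀ {x y : Symmetrify V}, Walk x y → Walk x y → Prop
  | refl {x y : Symmetrify V} (p : Walk x y) : Homotopic I p p
  | symm {x y : Symmetrify V} {p q : Walk x y} : Homotopic I p q → Homotopic I q p
  | trans {x y : Symmetrify V} {p q r : Walk x y} :
      Homotopic I p q → Homotopic I q r → Homotopic I p r
  | right_inv {x y : V} (α : x ⟶ y) :
      Homotopic I ((Hom.toNeg α).toPath.comp (Hom.toPos α).toPath : Walk y y) Path.nil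
  | left_inv {x y : V} (α : x ⟶ y) :
      Homotopic I ((Hom.toPos α).toPath.comp (Hom.toNeg α).toPath : Walk x x) Path.nil
  | congr {a b c d : Symmetrify V} (p : Walk a b) {q q' : Walk b c} (r : Walk c d) :
      Homotopic I q q' → Homotopic I (p.comp (q.comp r)) (p.comp (q'.comp r))
  | relation {x y : V} (r : PathAlgebra k V) (p q : Path x y) :
      IsMinimalRelation I r → (⟨x, y, p⟩ : OPath V) ∈ supp r →
      (⟨x, y, q⟩ : OPath V) ∈ supp r → Homotopic I (toWalk p) (toWalk q)

variable (I : Submodule k (PathAlgebra k V))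

theorem Homotopic.comp {a b c : Symmetrify V} {p p' : Walk a b} {q q' : Walk b c}
    (h : Homotopic I p p') (h' : Homotopic I q q') :
    Homotopic I (p.comp q) (p'.comp q') := by
  have h1 := Homotopic.congr Path.nil q h
  have h2 := Homotopic.congr p' Path.nil h'
  simp only [Path.nil_comp, Path.comp_nil] at h1 h2
  exact h1.trans h2

theorem Homotopic.comp_reverse {a b : Symmetrify V} (p : Walk a b) :
    Homotopic I (p.comp p.reverse) Path.nil := by
  induction p with
  | nil => exact Homotopic.refl _
  | @cons b c p e ih =>
    have h : Homotopic I (e.toPath.comp (Quiver.reverse e).toPath : Walk b b) Path.nil :=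
      match e with
      | Sum.inl α => Homotopic.left_inv α
      | Sum.inr α => Homotopic.right_inv α
    have h2 := Homotopic.congr p p.reverse h
    rw [Path.nil_comp] at h2
    have h3 : (p.cons e).comp (p.cons e).reverse
        = p.comp ((e.toPath.comp (Quiver.reverse e).toPath).comp p.reverse) := by
      rw [Path.reverse, ← Path.comp_toPath_eq_cons]
      simp only [Path.comp_assoc]
    rw [h3]
    exact h2.trans ih

theorem Homotopic.reverse_comp {a b : Symmetrify V} (p : Walk a b) :
    Homotopic I (p.reverse.comp p) Path.nil := by
  have h := Homotopic.comp_reverse I p.reverse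
  rwa [Path.reverse_reverse] at h

theorem Homotopic.reverse {a b : Symmetrify V} {p q : Walk a b} (h : Homotopic I p q) :
    Homotopic I p.reverse q.reverse := by
  have h1 : Homotopic I (p.reverse.comp (p.comp q.reverse)) p.reverse := by
    have := (Homotopic.refl (I := I) p.reverse).comp I
      ((h.comp I (Homotopic.refl q.reverse)).trans (Homotopic.comp_reverse I q))
    simpa only [Path.comp_nil] using this
  have h2 : Homotopic I (p.reverse.comp (p.comp q.reverse)) q.reverse := by
    have := (Homotopic.reverse_comp I p).comp I (Homotopic.refl q.reverse)
    simpa only [Path.nil_comp, Path.comp_assoc] using this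
  exact h1.symm.trans h2

theorem Homotopic.cancel_middle {a b c d e : Symmetrify V} (p : Walk a b) (q : Walk b c)
    (g : Walk e c) (r : Walk c d) (s : Walk d a) :
    Homotopic I ((p.comp (q.comp g.reverse)).comp (g.comp (r.comp s)))
      (p.comp ((q.comp r).comp s)) := by
  have h := Homotopic.congr (p.comp q) (r.comp s) (Homotopic.reverse_comp I g)
  simpa only [Path.comp_assoc, Path.nil_comp] using h

/-- Homotopy as an equivalence relation on the closed walks at `x₀`. -/
def loopSetoid (x₀ : Symmetrify V) : Setoid (Walk x₀ x₀) where
  r := Homotopic I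
  iseqv := ⟨Homotopic.refl, Homotopic.symm, Homotopic.trans⟩

/-- The fundamental group: homotopy classes of walks with source and target `x₀`. -/
def FundamentalGroup (x₀ : Symmetrify V) : Type (max u v) := Quotient (loopSetoid I x₀)

variable {x₀ : Symmetrify V}

/-- The homotopy class of a closed walk. -/
def FundamentalGroup.mk (p : Walk x₀ x₀) : FundamentalGroup I x₀ :=
  Quotient.mk (loopSetoid I x₀) p

theorem FundamentalGroup.sound {p q : Walk x₀ x₀} (h : Homotopic I p q) :
    FundamentalGroup.mk I p = FundamentalGroup.mk I q := Quotient.sound (s := loopSetoid I x₀) h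

/-- Composition of classes of closed walks is concatenation, read from right to left. -/
instance : Group (FundamentalGroup I x₀) where
  mul a b := Quotient.map₂ (fun p q : Walk x₀ x₀ => q.comp p)
    (fun _ _ h _ _ h' => Homotopic.comp I h' h) a b
  one := FundamentalGroup.mk I Path.nil
  inv a := Quotient.map (fun p : Walk x₀ x₀ => p.reverse)
    (fun _ _ h => Homotopic.reverse I h) a
  mul_assoc a b c := by
    induction a using Quotient.inductionOn
    induction b using Quotient.inductionOn
    induction c using Quotient.inductionOn
    exact congrArg (FundamentalGroup.mk I) (Path.comp_assoc _ _ _).symm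
  one_mul a := by
    induction a using Quotient.inductionOn
    exact congrArg (FundamentalGroup.mk I) (Path.comp_nil _)
  mul_one a := by
    induction a using Quotient.inductionOn
    exact congrArg (FundamentalGroup.mk I) (Path.nil_comp _)
  inv_mul_cancel a := by
    induction a using Quotient.inductionOn
    exact FundamentalGroup.sound I (Homotopic.comp_reverse I _)

theorem FundamentalGroup.mk_mul (p q : Walk x₀ x₀) :
    FundamentalGroup.mk I p * FundamentalGroup.mk I q = FundamentalGroup.mk I (q.comp p) := rfl

theorem FundamentalGroup.mk_nil :
    FundamentalGroup.mk I (Path.nil : Walk x₀ x₀) = 1 := rfl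

/-- The space `Hom(π₁, k⁺)` of additive characters of the fundamental group. -/
def Characters (x₀ : Symmetrify V) : Type (max u v w) := Additive (FundamentalGroup I x₀) →+ k

instance : AddCommGroup (Characters I x₀) :=
  inferInstanceAs (AddCommGroup (Additive (FundamentalGroup I x₀) →+ k))

instance : Module k (Characters I x₀) :=
  inferInstanceAs (Module k (Additive (FundamentalGroup I x₀) →+ k))

/-- `Hom(π₁, k⁺)` is an abelian Lie algebra. -/
instance : LieRing (Characters I x₀) where
  bracket _ _ := 0
  add_lie _ _ _ := (add_zero _).symm
  lie_add _ _ _ := (add_zero _).symm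
  lie_self _ := rfl
  leibniz_lie _ _ _ := (add_zero _).symm

instance : LieAlgebra k (Characters I x₀) where
  lie_smul _ _ _ := (smul_zero _).symm

variable {I}

/-- The value of a character at the class of a closed walk. -/
def Characters.eval (f : Characters I x₀) (p : Walk x₀ x₀) : k :=
  (show Additive (FundamentalGroup I x₀) →+ k from f) (Additive.ofMul (FundamentalGroup.mk I p))

theorem Characters.eval_comp (f : Characters I x₀) (p q : Walk x₀ x₀) :
    f.eval (p.comp q) = f.eval q + f.eval p := by
  unfold Characters.eval
  rw [← FundamentalGroup.mk_mul, ofMul_mul]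
  exact map_add _ _ _

theorem Characters.eval_congr (f : Characters I x₀) {p q : Walk x₀ x₀} (h : Homotopic I p q) :
    f.eval p = f.eval q := by
  unfold Characters.eval
  rw [FundamentalGroup.sound I h]

theorem Characters.eval_nil (f : Characters I x₀) : f.eval Path.nil = 0 := by
  unfold Characters.eval
  rw [FundamentalGroup.mk_nil, ofMul_one]
  exact map_zero _

end Homotopy

/-! ### Maximal trees -/

section Tree

variable {V : Type u} [Quiver.{v} V]

/-- The arrow of the double quiver `e` is an arrow of `T` or the formal inverse of one. -/
def ArrowIn (T : WideSubquiver V) {x y : Symmetrify V} : (x ⟶ y) → Prop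
  | Sum.inl α => α ∈ T x y
  | Sum.inr α => α ∈ T y x

/-- The walk only uses arrows of `T` and their formal inverses. -/
def WalkIn (T : WideSubquiver V) {x : Symmetrify V} : ∀ {y : Symmetrify V}, Walk x y → Prop
  | _, Path.nil => True
  | _, Path.cons p e => WalkIn T p ∧ ArrowIn T e

/-- The walk does not contain an arrow of the double quiver immediately followed by its inverse. -/
def IsReduced {x y : Symmetrify V} (p : Walk x y) : Prop :=
  ∀ (a b : Symmetrify V) (p₁ : Walk x a) (e : a ⟶ b) (p₂ : Walk a y),
    p ≠ p₁.comp (e.toPath.comp ((Quiver.reverse e).toPath.comp p₂))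

/-- `T`, a set of arrows together with all the vertices, is a maximal tree: its underlying graph
is a tree, that is, any two vertices are joined in `T` by exactly one reduced walk. -/
def IsMaximalTree (T : WideSubquiver V) : Prop :=
  ∀ x y : Symmetrify V, ∃! p : Walk x y, WalkIn T p ∧ IsReduced p

theorem exists_minimal_walk {T : WideSubquiver V} (hT : IsMaximalTree T) (x y : Symmetrify V) :
    ∃ p : Walk x y, WalkIn T p ∧ ∀ q : Walk x y, WalkIn T q → p.length ≤ q.length := by
  obtain ⟨p₀, ⟨h₀, -⟩, -⟩ := hT x y
  have hex : ∃ n, ∃ p : Walk x y, WalkIn T p ∧ p.length = n := ⟨_, p₀, h₀, rfl⟩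
  classical
  obtain ⟨p, hp, hl⟩ := Nat.find_spec hex
  exact ⟨p, hp, fun q hq => hl ▸ Nat.find_min' hex ⟨q, hq, rfl⟩⟩

/-- The walk `γ_x` in `T` with source `x₀`, target `x` and minimal length. -/
noncomputable def treeWalk {T : WideSubquiver V} (hT : IsMaximalTree T) (x₀ x : Symmetrify V) : Walk x₀ x :=
  (exists_minimal_walk hT x₀ x).choose

/-- The closed walk `γ_y⁻¹ u γ_x` at `x₀` defined by a path `u` from `x` to `y`. -/
noncomputable def treeLoop {T : WideSubquiver V} (hT : IsMaximalTree T) (x₀ : Symmetrify V) {x y : V}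
    (u : Path x y) : Walk x₀ x₀ :=
  (treeWalk hT x₀ x).comp ((toWalk u).comp (treeWalk hT x₀ y).reverse)

end Tree

/-! ### Derivations and the first Hochschild cohomology -/

section Hochschild

variable (k : Type w) [Field k] (A : Type z) [Ring A] [Algebra k A]

attribute [local instance 100] LieRing.ofAssociativeRing

/-- The Lie algebra of `k`-linear derivations of `A`, with the commutator as bracket. -/
def Der : LieSubalgebra k (Module.End k A) where
  carrier := {d | ∀ a b, d (a * b) = a * d b + d a * b}
  zero_mem' := by intro a b; simp
  add_mem' := by
    intro d d' h h' a b
    simp only [LinearMap.add_apply, h a b, h' a b, mul_add, add_mul]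
    abel
  smul_mem' := by
    intro c d h a b
    simp only [LinearMap.smul_apply, h a b, smul_add, mul_smul_comm, smul_mul_assoc]
  lie_mem' := by
    intro d d' h h' a b
    have h1 : ∀ a b, d (a * b) = a * d b + d a * b := h
    have h2 : ∀ a b, d' (a * b) = a * d' b + d' a * b := h'
    simp only [LieRing.of_associative_ring_bracket, LinearMap.sub_apply, Module.End.mul_apply,
      h1, h2, map_add, mul_sub, sub_mul]
    abel

variable {A} in
/-- The inner derivation `a ↦ c a - a c`. -/
def inner (c : A) : Module.End k A := LinearMap.mulLeft k c - LinearMap.mulRight k c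

theorem inner_mem (c : A) : inner k c ∈ Der k A := by
  intro a b
  simp only [inner, LinearMap.sub_apply, LinearMap.mulLeft_apply, LinearMap.mulRight_apply,
    mul_sub, sub_mul, mul_assoc]
  abel

/-- The ideal of inner derivations. -/
def Inn : LieIdeal k (Der k A) where
  carrier := {d | ∃ c : A, (d : Module.End k A) = inner k c}
  zero_mem' := ⟨0, by ext; simp [inner]⟩
  add_mem' := by
    rintro d d' ⟨c, h⟩ ⟨c', h'⟩
    refine ⟨c + c', ?_⟩
    have : ((d + d' : Der k A) : Module.End k A) = inner k c + inner k c' := by rw [← h, ← h']; rfl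
    ext a
    simp only [this, inner, LinearMap.add_apply, LinearMap.sub_apply,
      LinearMap.mulLeft_apply, LinearMap.mulRight_apply, add_mul, mul_add]
    abel
  smul_mem' := by
    rintro r d ⟨c, h⟩
    refine ⟨r • c, ?_⟩
    ext a
    simp [h, inner, smul_sub]
  lie_mem := by
    rintro d d' ⟨c, h⟩
    refine ⟨(d : Module.End k A) c, ?_⟩
    have hd : ∀ a b, (d : Module.End k A) (a * b) = a * (d : Module.End k A) b
      + (d : Module.End k A) a * b := d.2
    ext a
    rw [LieSubalgebra.coe_bracket, h]
    simp only [LieRing.of_associative_ring_bracket, LinearMap.sub_apply, Module.End.mul_apply,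
      inner, LinearMap.mulLeft_apply, LinearMap.mulRight_apply, map_sub, hd]
    abel

/-- The first Hochschild cohomology of `A` with coefficients in `A`, with its Lie algebra
structure: derivations modulo inner derivations. -/
abbrev HH1 := Der k A ⧸ Inn k A

variable {A} {V : Type u} (e : V → A)

/-- The Lie algebra of unitary derivations: those vanishing on the idempotents `e x`. -/
def Der₀ : LieSubalgebra k (Module.End k A) where
  carrier := {d | d ∈ Der k A ∧ ∀ x, d (e x) = 0}
  zero_mem' := ⟨(Der k A).zero_mem, by simp⟩
  add_mem' h h' := ⟨(Der k A).add_mem h.1 h'.1, fun x => by simp [h.2 x, h'.2 x]⟩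
  smul_mem' c _ h := ⟨(Der k A).smul_mem c h.1, fun x => by simp [h.2 x]⟩
  lie_mem' h h' := ⟨(Der k A).lie_mem h.1 h'.1, fun x => by
    simp [LieRing.of_associative_ring_bracket, h.2 x, h'.2 x]⟩

/-- The ideal of the inner derivations `a ↦ c a - a c` with `c` in the span of the `e x`. -/
def Int₀ : LieIdeal k (Der₀ k e) where
  carrier := {d | ∃ c ∈ Submodule.span k (Set.range e), (d : Module.End k A) = inner k c}
  zero_mem' := ⟨0, Submodule.zero_mem _, by ext; simp [inner]⟩
  add_mem' := by
    rintro d d' ⟨c, hc, h⟩ ⟨c', hc', h'⟩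
    refine ⟨c + c', Submodule.add_mem _ hc hc', ?_⟩
    have : ((d + d' : Der₀ k e) : Module.End k A) = inner k c + inner k c' := by rw [← h, ← h']; rfl
    ext a
    simp only [this, inner, LinearMap.add_apply, LinearMap.sub_apply,
      LinearMap.mulLeft_apply, LinearMap.mulRight_apply, add_mul, mul_add]
    abel
  smul_mem' := by
    rintro r d ⟨c, hc, h⟩
    refine ⟨r • c, Submodule.smul_mem _ _ hc, ?_⟩
    ext a
    simp [h, inner, smul_sub]
  lie_mem := by
    rintro d d' ⟨c, hc, h⟩
    refine ⟨0, Submodule.zero_mem _, ?_⟩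
    have hd : ∀ a b, (d : Module.End k A) (a * b) = a * (d : Module.End k A) b
      + (d : Module.End k A) a * b := d.2.1
    have hz : (d : Module.End k A) c = 0 := by
      have hle : Submodule.span k (Set.range e) ≤ LinearMap.ker (d : Module.End k A) := by
        rw [Submodule.span_le]
        rintro _ ⟨x, rfl⟩
        exact d.2.2 x
      exact hle hc
    ext a
    rw [LieSubalgebra.coe_bracket, h]
    simp only [LieRing.of_associative_ring_bracket, LinearMap.sub_apply, Module.End.mul_apply,
      inner, LinearMap.mulLeft_apply, LinearMap.mulRight_apply, map_sub, hd, hz]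
    simp

/-- The quotient of the Lie algebra of unitary derivations by the ideal of the inner derivations
defined by the span of the idempotents. -/
abbrev HH1₀ := Der₀ k e ⧸ Int₀ k e

/-- The inclusion of unitary derivations into derivations. -/
def Der₀.toDer : Der₀ k e →ₗ[k] Der k A :=
  Submodule.inclusion (p := (Der₀ k e).toSubmodule) (p' := (Der k A).toSubmodule) fun _ h => h.1

/-- The canonical map `Der₀ / Int₀ → HH¹(A)` induced by the inclusion of unitary derivations
into derivations. -/
def HH1₀.toHH1 : HH1₀ k e →ₗ⁅k⁆ HH1 k A :=
  { Submodule.mapQ (Int₀ k e).toSubmodule (Inn k A).toSubmodule (Der₀.toDer k e)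
      (by rintro d ⟨c, -, h⟩; exact ⟨c, h⟩) with
    map_lie' := by
      intro a b
      induction a using Quotient.inductionOn'
      induction b using Quotient.inductionOn'
      rfl }

end Hochschild

/-! ### The homomorphism from additive characters to the Hochschild cohomology -/

section Theta

variable {k : Type w} [Field k] {V : Type u} [Quiver.{v} V] [Fintype V]
  {A : Type z} [Ring A] [Algebra k A]

/-- The kernel of an algebra homomorphism from the path algebra. -/
noncomputable def relations (ν : PathAlgebra k V →ₐ[k] A) : Submodule k (PathAlgebra k V) :=
  LinearMap.ker ν.toLinearMap

/-- A presentation of `A` by the quiver `V` and admissible relations. -/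
structure IsPresentation (ν : PathAlgebra k V →ₐ[k] A) : Prop where
  surjective : Function.Surjective ν
  admissible : IsAdmissible (relations ν)

/-- The idempotent `e_x = ν(e_x)` of `A` attached to the vertex `x`. -/
noncomputable def idem (ν : PathAlgebra k V →ₐ[k] A) (x : V) : A :=
  ν (ofPath k (Path.nil : Path x x))

/-- The subspace `e A e'` of `A`. -/
def corner (k : Type w) [Field k] {A : Type z} [Ring A] [Algebra k A] (e e' : A) :
    Submodule k A :=
  LinearMap.range (LinearMap.mulLeft k e ∘ₗ LinearMap.mulRight k e')

/-- `A` is constricted: `dim e_y A e_x = 1` for every arrow `x ⟶ y`. -/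
def IsConstricted (ν : PathAlgebra k V →ₐ[k] A) : Prop :=
  ∀ (x y : V), Nonempty (x ⟶ y) → Module.finrank k (corner k (idem ν y) (idem ν x)) = 1

variable {T : WideSubquiver V} (hT : IsMaximalTree T) (x₀ : Symmetrify V)
  (ν : PathAlgebra k V →ₐ[k] A)

/-- The linear endomorphism of the path algebra which multiplies every path `u` from `x` to `y`
by `f [γ_y⁻¹ u γ_x]`. -/
noncomputable def scale {I : Submodule k (PathAlgebra k V)} (f : Characters I x₀) :
    PathAlgebra k V →ₗ[k] PathAlgebra k V :=
  Finsupp.linearCombination k fun p : OPath V => f.eval (treeLoop hT x₀ p.path) • single k p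

theorem scale_single {I : Submodule k (PathAlgebra k V)} (f : Characters I x₀) (p : OPath V) :
    scale hT x₀ f (single k p) = f.eval (treeLoop hT x₀ p.path) • single k p := by
  unfold scale single
  erw [Finsupp.linearCombination_single, one_smul]

theorem scale_ofPath {I : Submodule k (PathAlgebra k V)} (f : Characters I x₀)
    {x y : V} (u : Path x y) :
    scale hT x₀ f (ofPath k u) = f.eval (treeLoop hT x₀ u) • ofPath k u :=
  scale_single hT x₀ f ⟨x, y, u⟩

theorem eval_treeLoop_nil {I : Submodule k (PathAlgebra k V)} (f : Characters I x₀) (x : V) :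
    f.eval (treeLoop hT x₀ (Path.nil : Path x x)) = 0 := by
  rw [f.eval_congr (q := Path.nil), f.eval_nil]
  have := Homotopic.comp_reverse I (treeWalk hT x₀ x)
  unfold treeLoop
  erw [Path.nil_comp]
  exact this

theorem eval_treeLoop_comp {I : Submodule k (PathAlgebra k V)} (f : Characters I x₀) {x y t : V}
    (u : Path x y) (q : Path y t) :
    f.eval (treeLoop hT x₀ (u.comp q))
      = f.eval (treeLoop hT x₀ q) + f.eval (treeLoop hT x₀ u) := by
  rw [← f.eval_comp]
  refine (f.eval_congr ?_).symm
  have e1 : (toWalk (u.comp q)) = (toWalk u).comp (toWalk q) := Prefunctor.mapPath_comp _ _ _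
  unfold treeLoop
  rw [e1]
  exact Homotopic.cancel_middle I _ _ _ _ _

theorem coeff_subsum [DecidableEq (OPath V)] (r : PathAlgebra k V) (S : Finset (OPath V))
    (p : OPath V) : coeff (subsum r S) p = if p ∈ S then coeff r p else 0 := by
  have h : coeff (subsum r S) p = ∑ q ∈ S, coeff (coeff r q • single k q) p :=
    Finsupp.finsetSum_apply (N := k) S (fun q => coeff r q • single k q) p
  rw [h]
  have h2 : ∀ q, coeff (coeff r q • single k q) p = if q = p then coeff r p else 0 := by
    intro q
    have : coeff (coeff r q • single k q) p = coeff r q * (Finsupp.single q (1 : k)) p := rfl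
    rw [this, Finsupp.single_apply]
    split_ifs with hq
    · rw [hq, mul_one]
    · rw [mul_zero]
  simp only [h2, Finset.sum_ite_eq']

theorem supp_subsum (r : PathAlgebra k V) (S : Finset (OPath V)) : supp (subsum r S) ⊆ S := by
  classical
  intro p hp
  rw [mem_supp, coeff_subsum] at hp
  by_contra h
  exact hp (if_neg h)

theorem corner_subsum (r : PathAlgebra k V) (x y : V) [DecidableEq V] :
    ofPath k (Path.nil : Path y y) * r * ofPath k (Path.nil : Path x x)
      = subsum r ((supp r).filter fun p => p.src = x ∧ p.tgt = y) := by
  conv_lhs => rw [eq_subsum r]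
  unfold subsum
  rw [Finset.mul_sum, Finset.sum_mul, Finset.sum_filter]
  refine Finset.sum_congr rfl fun p _ => ?_
  obtain ⟨a, b, p⟩ := p
  rw [mul_smul_comm, smul_mul_assoc]
  change _ • (_ * ofPath k p * _) = _
  by_cases hb : b = y
  · subst hb
    rw [ofPath_mul_ofPath, Path.comp_nil]
    by_cases ha : a = x
    · subst ha
      rw [ofPath_mul_ofPath, Path.nil_comp]
      simp [ofPath]
    · rw [ofPath_mul_ofPath_of_ne _ _ _ (Ne.symm ha)]
      simp [ha]
  · rw [ofPath_mul_ofPath_of_ne _ _ _ hb]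
    simp [hb]

theorem scale_mem_of_minimal (f : Characters (relations ν) x₀) (r : PathAlgebra k V)
    (hr : IsMinimalRelation (relations ν) r) : scale hT x₀ f r ∈ relations ν := by
  classical
  obtain ⟨hrI, hr0, hmin⟩ := hr
  have hne : (supp r).Nonempty := by
    rw [Finset.nonempty_iff_ne_empty]
    intro h
    apply hr0
    rw [eq_subsum r, h]
    rfl
  obtain ⟨⟨x, y, p⟩, hp⟩ := hne
  have hS : (supp r).filter (fun q => q.src = x ∧ q.tgt = y) = supp r := by
    by_contra hS
    refine hmin _ ⟨⟨x, y, p⟩, ?_⟩ ((Finset.filter_subset _ _).ssubset_of_ne hS) ?_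
    · simp [hp]
    · rw [← corner_subsum]
      have hν : ν r = 0 := hrI
      change ν _ = 0
      rw [map_mul, map_mul, hν, mul_zero, zero_mul]
  have hc : ∀ q ∈ supp r,
      f.eval (treeLoop hT x₀ q.path) = f.eval (treeLoop hT x₀ p) := by
    rintro ⟨a, b, q⟩ hq
    have hq' := hq
    rw [← hS, Finset.mem_filter] at hq'
    obtain ⟨-, h1, h2⟩ := hq'
    dsimp only at h1 h2
    subst h1 h2
    exact f.eval_congr (Homotopic.congr _ _ (Homotopic.relation r q p ⟨hrI, hr0, hmin⟩ hq hp))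
  have : scale hT x₀ f r = f.eval (treeLoop hT x₀ p) • r := by
    conv_lhs => rw [eq_subsum r]
    conv_rhs => rw [eq_subsum r]
    unfold subsum
    rw [map_sum, Finset.smul_sum]
    refine Finset.sum_congr rfl fun q hq => ?_
    rw [map_smul, scale_single, hc q hq, smul_comm]
  rw [this]
  exact Submodule.smul_mem _ _ hrI

theorem scale_mem (f : Characters (relations ν) x₀) (r : PathAlgebra k V)
    (hr : r ∈ relations ν) : scale hT x₀ f r ∈ relations ν := by
  classical
  induction hn : (supp r).card using Nat.strong_induction_on generalizing r with
  | _ n ih =>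
    by_cases h0 : r = 0
    · rw [h0, map_zero]
      exact Submodule.zero_mem _
    by_cases hm : IsMinimalRelation (relations ν) r
    · exact scale_mem_of_minimal hT x₀ ν f r hm
    · have : ∃ S : Finset (OPath V), S.Nonempty ∧ S ⊂ supp r ∧ subsum r S ∈ relations ν := by
        by_contra hS
        push Not at hS
        exact hm ⟨hr, h0, hS⟩
      obtain ⟨S, hSn, hS, hSI⟩ := this
      have hsum : r = subsum r S + subsum r (supp r \ S) := by
        conv_lhs => rw [eq_subsum r]
        unfold subsum
        rw [add_comm, Finset.sum_sdiff hS.1]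
      have hSI' : subsum r (supp r \ S) ∈ relations ν := by
        have := Submodule.sub_mem _ hr hSI
        rwa [sub_eq_of_eq_add' hsum] at this
      rw [hsum, map_add]
      refine Submodule.add_mem _ (ih _ ?_ _ hSI rfl) (ih _ ?_ _ hSI' rfl)
      · rw [← hn]
        exact (Finset.card_le_card (supp_subsum r S)).trans_lt (Finset.card_lt_card hS)
      · rw [← hn]
        refine (Finset.card_le_card (supp_subsum r _)).trans_lt (Finset.card_lt_card ?_)
        exact Finset.sdiff_ssubset hS.1 hSn

variable {ν}

/-- The derivation `f̃` of `A` defined by a character `f`, as a linear map: it sends `ν(u)` to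
`f [γ_y⁻¹ u γ_x] ν(u)` for every path `u` from `x` to `y`. -/
noncomputable def tilde (hν : Function.Surjective ν) (f : Characters (relations ν) x₀) :
    Module.End k A :=
  (Submodule.liftQ (relations ν) (ν.toLinearMap ∘ₗ scale hT x₀ f)
      (by
        intro r hr
        exact scale_mem hT x₀ ν f r hr)) ∘ₗ
    (ν.toLinearMap.quotKerEquivOfSurjective hν).symm.toLinearMap

theorem tilde_apply (hν : Function.Surjective ν) (f : Characters (relations ν) x₀)
    (r : PathAlgebra k V) : tilde hT x₀ hν f (ν r) = ν (scale hT x₀ f r) := by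
  have h : (ν.toLinearMap.quotKerEquivOfSurjective hν).symm (ν r)
      = Submodule.Quotient.mk r := by
    rw [LinearEquiv.symm_apply_eq]
    rfl
  have hle : relations ν ≤ LinearMap.ker (ν.toLinearMap ∘ₗ scale hT x₀ f) := by
    intro r hr
    exact scale_mem hT x₀ ν f r hr
  change Submodule.liftQ (relations ν) (ν.toLinearMap ∘ₗ scale hT x₀ f) hle
    ((ν.toLinearMap.quotKerEquivOfSurjective hν).symm (ν r)) = _
  rw [h]
  rfl

theorem tilde_ofPath (hν : Function.Surjective ν) (f : Characters (relations ν) x₀)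
    {x y : V} (u : Path x y) :
    tilde hT x₀ hν f (ν (ofPath k u)) = f.eval (treeLoop hT x₀ u) • ν (ofPath k u) := by
  rw [tilde_apply, scale_ofPath, map_smul]

theorem scale_mul {I : Submodule k (PathAlgebra k V)} (f : Characters I x₀)
    (a b : PathAlgebra k V) :
    scale hT x₀ f (a * b) = a * scale hT x₀ f b + scale hT x₀ f a * b := by
  induction a using path_induction with
  | zero => simp
  | add _ _ h1 h2 => rw [add_mul, map_add, h1, h2, map_add, add_mul, add_mul]; abel
  | smul _ _ h => rw [smul_mul_assoc, map_smul, h, map_smul, smul_mul_assoc, smul_mul_assoc,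
      smul_add]
  | path y' t q =>
  induction b using path_induction with
  | zero => simp
  | add _ _ h1 h2 => rw [mul_add, map_add, h1, h2, map_add, mul_add, mul_add]; abel
  | smul _ _ h => rw [mul_smul_comm, map_smul, h, map_smul, mul_smul_comm, mul_smul_comm,
      smul_add]
  | path x y p =>
  rw [scale_ofPath, scale_ofPath, mul_smul_comm, smul_mul_assoc]
  by_cases h : y = y'
  · subst h
    rw [ofPath_mul_ofPath, scale_ofPath, eval_treeLoop_comp, add_smul, add_comm]
  · rw [ofPath_mul_ofPath_of_ne _ _ _ h]
    simp

theorem tilde_mem (hν : Function.Surjective ν) (f : Characters (relations ν) x₀) :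
    tilde hT x₀ hν f ∈ Der₀ k (idem ν) := by
  refine ⟨fun a b => ?_, fun x => ?_⟩
  · obtain ⟨a, rfl⟩ := hν a
    obtain ⟨b, rfl⟩ := hν b
    rw [← map_mul, tilde_apply, tilde_apply, tilde_apply, scale_mul, map_add, map_mul, map_mul]
  · unfold idem
    rw [tilde_ofPath, eval_treeLoop_nil, zero_smul]

theorem linearMap_ext_path (hν : Function.Surjective ν) {d d' : Module.End k A}
    (h : ∀ (x y : V) (u : Path x y), d (ν (ofPath k u)) = d' (ν (ofPath k u))) : d = d' := by
  ext a
  obtain ⟨a, rfl⟩ := hν a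
  induction a using path_induction with
  | zero => simp
  | add _ _ h1 h2 => rw [map_add, map_add, map_add, h1, h2]
  | smul _ _ h => rw [map_smul, map_smul, map_smul, h]
  | path x y p => exact h x y p

/-- The linear map `f ↦ f̃` from characters to unitary derivations. -/
noncomputable def tildeLin (hν : Function.Surjective ν) :
    Characters (relations ν) x₀ →ₗ[k] Der₀ k (idem ν) where
  toFun f := ⟨tilde hT x₀ hν f, tilde_mem hT x₀ hν f⟩
  map_add' f g := by
    apply Subtype.ext
    refine linearMap_ext_path hν fun x y u => ?_
    change tilde hT x₀ hν (f + g) _ = tilde hT x₀ hν f _ + tilde hT x₀ hν g _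
    simp only [tilde_ofPath]
    rw [← add_smul]
    rfl
  map_smul' c f := by
    apply Subtype.ext
    refine linearMap_ext_path hν fun x y u => ?_
    change tilde hT x₀ hν (c • f) _ = c • tilde hT x₀ hν f _
    simp only [tilde_ofPath]
    rw [smul_smul]
    rfl

theorem tilde_comm (hν : Function.Surjective ν) (f g : Characters (relations ν) x₀) :
    ⁅tildeLin hT x₀ hν f, tildeLin hT x₀ hν g⁆ = 0 := by
  apply Subtype.ext
  refine linearMap_ext_path hν fun x y u => ?_
  change tilde hT x₀ hν f (tilde hT x₀ hν g _) - tilde hT x₀ hν g (tilde hT x₀ hν f _) = 0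
  simp only [tilde_ofPath, map_smul]
  rw [smul_comm, sub_self]

/-- The Lie algebra homomorphism `θ_ν : Hom(π₁(Q, Ker ν), k⁺) → Der₀(A) / Int₀(A)`, sending a
character `f` to the class of the derivation `f̃`. -/
noncomputable def theta (hν : IsPresentation ν) :
    Characters (relations ν) x₀ →ₗ⁅k⁆ HH1₀ k (idem ν) :=
  { (Int₀ k (idem ν)).toSubmodule.mkQ ∘ₗ tildeLin hT x₀ hν.surjective with
    map_lie' := by
      intro f g
      change Submodule.Quotient.mk (tildeLin hT x₀ hν.surjective 0)
        = Submodule.Quotient.mk ⁅tildeLin hT x₀ hν.surjective f, tildeLin hT x₀ hν.surjective g⁆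
      rw [tilde_comm, map_zero] }

end Theta

end BoundQuiver

/-! A derivation that multiplies the image of every path by a scalar amounts to an additive weight
on arrows, and everything reduces to comparing such weights with characters of the fundamental
group. If A is constricted, a unitary derivation `d` maps each arrow into a one-dimensional corner
spanned by that arrow, so it scales arrows (`exists_arrow_weight`) and hence, by Leibniz, every path
(`der_ofPath`). Grouping the paths of a minimal relation by eigenvalue splits the relation inside
Ker ν; minimality leaves a single eigenvalue (`weight_eq_of_minimal`). The weight is therefore
homotopy invariant and defines a character `f`. On paths, the derivation of `f` and `d` differ by a
coboundary c_y - c_x, which is the action of the inner derivation of ∑ c_x e_x (`inner_sum_ofPath`):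
this is surjectivity of `theta`. Conversely, if the derivation of `f` is inner by a diagonal
element, then `f` is a coboundary on the loops of arrows, because arrows are nonzero in A; it
telescopes to 0 on closed walks (`Characters.eq_zero_of_arrows`). The comparison with HH¹ holds
because any derivation becomes unitary after subtracting an inner one (`toHH1_surjective`), while an
element commuting with all e_x is diagonal when there are no oriented cycles (`toHH1_injective`).
HH¹ is then the image of an abelian Lie algebra. -/

namespace BoundQuiver

open Quiver

/-! ### Additive weights on walks and the characters they define. -/

section Weights

variable {V : Type u} [Quiver.{v} V] {k : Type w} [Field k]

/-- The sum of the weights of the arrows of a walk, inverse arrows counting negatively. -/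
def walkWeight (t : ∀ x y : V, (x ⟶ y) → k) {x : Symmetrify V} :
    ∀ {y : Symmetrify V}, Walk x y → k
  | _, Path.nil => 0
  | _, Path.cons p (Sum.inl α) => walkWeight t p + t _ _ α
  | _, Path.cons p (Sum.inr α) => walkWeight t p - t _ _ α

variable (t : ∀ x y : V, (x ⟶ y) → k)

theorem walkWeight_comp {x y z : Symmetrify V} (p : Walk x y) (q : Walk y z) :
    walkWeight t (p.comp q) = walkWeight t p + walkWeight t q := by
  induction q with
  | nil => simp [walkWeight]
  | cons q e ih =>
    match e with
    | Sum.inl α => simp only [Path.comp_cons, walkWeight, ih]; ring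
    | Sum.inr α => simp only [Path.comp_cons, walkWeight, ih]; ring

/-- Additivity and the sign on inverse arrows already respect every other generator of homotopy, so
minimal relations are the only condition to check. -/
theorem walkWeight_homotopic {I : Submodule k (PathAlgebra k V)}
    (h : ∀ (r : PathAlgebra k V) {x y : V} (p q : Path x y), IsMinimalRelation I r →
      (⟨x, y, p⟩ : OPath V) ∈ supp r → (⟨x, y, q⟩ : OPath V) ∈ supp r →
      walkWeight t (toWalk p) = walkWeight t (toWalk q))
    {x y : Symmetrify V} {p q : Walk x y} (hpq : Homotopic I p q) :
    walkWeight t p = walkWeight t q := by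
  induction hpq with
  | refl p => rfl
  | symm _ ih => exact ih.symm
  | trans _ _ ih ih' => exact ih.trans ih'
  | right_inv α =>
    change (0 - t _ _ α) + t _ _ α = (0 : k)
    ring
  | left_inv α =>
    change (0 + t _ _ α) - t _ _ α = (0 : k)
    ring
  | congr p r _ ih => simp only [walkWeight_comp, ih]
  | relation r p q hr hp hq => exact h r p q hr hp hq

theorem walkWeight_reverse {x y : Symmetrify V} (p : Walk x y) :
    walkWeight t p.reverse = -walkWeight t p := by
  induction p with
  | nil => simp [walkWeight]
  | cons p e ih =>
    rw [Path.reverse, walkWeight_comp, ih]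
    match e with
    | Sum.inl α =>
      change (0 - t _ _ α) + _ = -(_ + t _ _ α)
      ring
    | Sum.inr α =>
      change (0 + t _ _ α) + _ = -(_ - t _ _ α)
      ring

/-- The character of the fundamental group defined by a homotopy invariant weight. -/
def weightCharacter {I : Submodule k (PathAlgebra k V)} (x₀ : Symmetrify V)
    (h : ∀ {p q : Walk x₀ x₀}, Homotopic I p q → walkWeight t p = walkWeight t q) :
    Characters I x₀ :=
  (AddMonoidHom.mk' (fun a : Additive (FundamentalGroup I x₀) =>
      Quotient.lift (s := loopSetoid I x₀) (fun p : Walk x₀ x₀ => walkWeight t p)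
        (fun _ _ hpq => h hpq) a.toMul) (by
      intro a b
      induction a using Quotient.inductionOn
      induction b using Quotient.inductionOn
      -- The product of classes concatenates walks in the opposite order, which commutativity of k
      -- absorbs.
      exact (walkWeight_comp t _ _).trans (add_comm _ _)) :
    Additive (FundamentalGroup I x₀) →+ k)

/-- Closing up a path through the tree changes its weight by a coboundary; this is the inner
correction in `theta_surjective`. -/
theorem walkWeight_treeLoop {T : WideSubquiver V} (hT : IsMaximalTree T) (x₀ : Symmetrify V)
    {x y : V} (u : Path x y) : walkWeight t (treeLoop hT x₀ u) = walkWeight t (treeWalk hT x₀ x)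
      + (walkWeight t (toWalk u) - walkWeight t (treeWalk hT x₀ y)) := by
  refine (walkWeight_comp t _ _).trans (congrArg _ ((walkWeight_comp t _ _).trans ?_))
  exact (congrArg _ (walkWeight_reverse t _)).trans (sub_eq_add_neg _ _).symm

theorem weightCharacter_eval {I : Submodule k (PathAlgebra k V)} (x₀ : Symmetrify V)
    (h : ∀ {p q : Walk x₀ x₀}, Homotopic I p q → walkWeight t p = walkWeight t q)
    (p : Walk x₀ x₀) : (weightCharacter t x₀ h).eval p = walkWeight t p := rfl

end Weights

/-! ### Characters that are coboundaries on arrows vanish. -/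

section Characters

variable {V : Type u} [Quiver.{v} V] {k : Type w} [Field k]
  {T : WideSubquiver V} (hT : IsMaximalTree T) {x₀ : Symmetrify V}
  {I : Submodule k (PathAlgebra k V)}

theorem Characters.eval_reverse (f : Characters I x₀) (p : Walk x₀ x₀) :
    f.eval p.reverse = -f.eval p := by
  rw [eq_neg_iff_add_eq_zero, ← f.eval_comp, f.eval_congr (Homotopic.comp_reverse I p), f.eval_nil]

/-- The two closed walks are conjugate by the class of `p.comp g.reverse`, and a character with
commutative target is constant on conjugacy classes. -/
theorem Characters.eval_conj (f : Characters I x₀) {x : Symmetrify V} (p : Walk x₀ x)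
    {q : Walk x x} (g : Walk x₀ x) :
    f.eval (p.comp (q.comp p.reverse)) = f.eval (g.comp (q.comp g.reverse)) := by
  have h : Homotopic I (p.comp (q.comp p.reverse))
      ((p.comp g.reverse).comp ((g.comp (q.comp g.reverse)).comp (p.comp g.reverse).reverse)) := by
    have h1 := Homotopic.congr p (q.comp (g.reverse.comp (g.comp p.reverse)))
      (Homotopic.reverse_comp I g)
    have h2 := Homotopic.congr (p.comp q) p.reverse (Homotopic.reverse_comp I g)
    simp only [Path.comp_assoc, Path.nil_comp, Path.reverse_comp, Path.reverse_reverse] at h1 h2 ⊢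
    exact (h1.trans h2).symm
  rw [f.eval_congr h, f.eval_comp, f.eval_comp, f.eval_reverse]
  ring

/-- The value of a character at `γ_y⁻¹ u γ_x` is determined additively by its values at the
arrows; here these values are a coboundary. -/
theorem Characters.eval_of_arrows (f : Characters I x₀) (c : V → k)
    (h : ∀ {x y : V} (α : x ⟶ y), f.eval (treeLoop hT x₀ α.toPath) = c y - c x)
    {x y : Symmetrify V} (p : Walk x y) :
    f.eval ((treeWalk hT x₀ x).comp (p.comp (treeWalk hT x₀ y).reverse))
      = c (show V from y) - c (show V from x) := by
  induction p with
  | nil =>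
    rw [Path.nil_comp, f.eval_congr (Homotopic.comp_reverse I _), f.eval_nil, sub_self]
  | @cons y z p e ih =>
    -- Inserting γ_y⁻¹γ_y before the last arrow splits the loop into the loop of `p` and the loop of
    -- one arrow, so the sum telescopes.
    rw [← Path.comp_toPath_eq_cons,
      ← f.eval_congr (Homotopic.cancel_middle I _ p (treeWalk hT x₀ y) e.toPath _), f.eval_comp, ih]
    match e with
    | Sum.inl α =>
      have := h α
      change f.eval ((treeWalk hT x₀ y).comp (_)) = _ at this
      erw [this]
      ring
    | Sum.inr α =>
      -- The loop of an inverse arrow is the reverse of the loop of the arrow, hence the change of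
      -- sign.
      have := h α
      rw [← neg_inj, ← f.eval_reverse] at this
      unfold treeLoop at this
      rw [Path.reverse_comp, Path.reverse_comp, Path.reverse_reverse, Path.comp_assoc] at this
      erw [this]
      ring

theorem Characters.eq_zero_of_arrows (f : Characters I x₀) (c : V → k)
    (h : ∀ {x y : V} (α : x ⟶ y), f.eval (treeLoop hT x₀ α.toPath) = c y - c x) : f = 0 := by
  have h0 : ∀ p : Walk x₀ x₀, f.eval p = 0 := by
    intro p
    have h1 := f.eval_of_arrows hT c h p
    -- Replacing the tree walk from x₀ to itself by the trivial walk avoids having to identify it.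
    rw [f.eval_conj _ Path.nil, sub_self] at h1
    simpa using h1
  refine AddMonoidHom.ext (M := Additive (FundamentalGroup I x₀)) (N := k) fun a => ?_
  induction a using Quotient.inductionOn
  exact h0 _

end Characters

/-! ### The length filtration of the path algebra, and arrows outside (kQ⁺)². -/

section Length

/-- The span of the paths of length at least `n`. -/
noncomputable def lengthFiltration (k : Type w) [Field k] (V : Type u) [Quiver.{v} V] (n : ℕ) : Submodule k (PathAlgebra k V) :=
  Submodule.span k {a | ∃ (x y : V) (p : Path x y), n ≤ p.length ∧ a = ofPath k p}

variable {V : Type u} [Quiver.{v} V] (k : Type w) [Field k]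

theorem coeff_eq_zero_of_mem_lengthFiltration {n : ℕ} {a : PathAlgebra k V}
    (ha : a ∈ lengthFiltration k V n) (p : OPath V) (hp : p.path.length < n) : coeff a p = 0 := by
  induction ha using Submodule.span_induction with
  | mem a h =>
    obtain ⟨x, y, q, hq, rfl⟩ := h
    refine Finsupp.single_eq_of_ne (M := k) ?_
    rintro rfl
    exact absurd hq (not_le.2 hp)
  | zero => rfl
  | add a b _ _ h1 h2 =>
    change coeff a p + coeff b p = 0
    rw [h1, h2, add_zero]
  | smul c a _ h =>
    change c * coeff a p = 0
    rw [h, mul_zero]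

variable [Fintype V]

theorem lengthFiltration_mul (m n : ℕ) :
    lengthFiltration k V m * lengthFiltration k V n ≤ lengthFiltration k V (m + n) := by
  unfold lengthFiltration
  rw [Submodule.span_mul_span, Submodule.span_le]
  rintro _ ⟨_, ⟨y', z, q, hq, rfl⟩, _, ⟨x, y, p, hp, rfl⟩, rfl⟩
  dsimp only
  by_cases h : y = y'
  · subst h
    rw [ofPath_mul_ofPath]
    refine Submodule.subset_span ⟨_, _, _, ?_, rfl⟩
    rw [Path.length_comp]
    omega
  · rw [ofPath_mul_ofPath_of_ne _ _ _ h]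
    exact Submodule.zero_mem _

/-- The three factors of the ideal lie in filtration degrees 0, 1 and 0, and degrees add under
multiplication. -/
theorem arrowIdeal_le_lengthFiltration : arrowIdeal k V ≤ lengthFiltration k V 1 := by
  have htop : (⊤ : Submodule k (PathAlgebra k V)) ≤ lengthFiltration k V 0 := by
    rw [← span_ofPath k]
    refine Submodule.span_mono ?_
    rintro _ ⟨x, y, p, rfl⟩
    exact ⟨x, y, p, Nat.zero_le _, rfl⟩
  have harr : Submodule.span k {a | ∃ (x y : V) (α : x ⟶ y), a = ofPath k α.toPath}
      ≤ lengthFiltration k V 1 := by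
    refine Submodule.span_mono ?_
    rintro _ ⟨x, y, α, rfl⟩
    exact ⟨x, y, α.toPath, by simp, rfl⟩
  exact (mul_le_mul' ((mul_le_mul' htop harr).trans
    (lengthFiltration_mul k 0 1)) htop).trans (lengthFiltration_mul k 1 0)

/-- Elements of (kQ⁺)² have filtration degree at least 2, so their coefficients on paths of length 1
vanish. -/
theorem ofPath_arrow_notMem {x y : V} (α : x ⟶ y) : ofPath k α.toPath ∉ arrowIdeal k V ^ 2 := by
  intro h
  rw [sq] at h
  have h2 := lengthFiltration_mul k 1 1 (mul_le_mul'
    (arrowIdeal_le_lengthFiltration k) (arrowIdeal_le_lengthFiltration k) h)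
  have h3 := coeff_eq_zero_of_mem_lengthFiltration k h2 ⟨x, y, α.toPath⟩ (by simp)
  have h4 : coeff (ofPath k α.toPath) (⟨x, y, α.toPath⟩ : OPath V) = 1 :=
    Finsupp.single_eq_same (M := k)
  exact one_ne_zero (h4.symm.trans h3)

end Length

/-! ### Diagonal inner derivations, and unitary derivations acting by weights. -/

section Derivations

variable {k : Type w} [Field k] {V : Type u} [Quiver.{v} V] [Fintype V]
  {A : Type z} [Ring A] [Algebra k A] (ν : PathAlgebra k V →ₐ[k] A)

theorem sum_idem : ∑ x : V, idem ν x = 1 := by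
  unfold idem
  rw [← map_sum, ← one_def, map_one]

theorem idem_mul_self (x : V) : idem ν x * idem ν x = idem ν x := by
  unfold idem
  rw [← map_mul, ofPath_mul_ofPath, Path.comp_nil]

theorem idem_mul_of_ne {x y : V} (h : x ≠ y) : idem ν x * idem ν y = 0 := by
  unfold idem
  rw [← map_mul, ofPath_mul_ofPath_of_ne _ _ _ h.symm, map_zero]

theorem idem_mul_ofPath {x y : V} (p : Path x y) :
    idem ν y * ν (ofPath k p) = ν (ofPath k p) := by
  unfold idem
  rw [← map_mul, ofPath_mul_ofPath, Path.comp_nil]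

theorem ofPath_mul_idem {x y : V} (p : Path x y) :
    ν (ofPath k p) * idem ν x = ν (ofPath k p) := by
  unfold idem
  rw [← map_mul, ofPath_mul_ofPath, Path.nil_comp]

theorem idem_mul_ofPath_of_ne {x y y' : V} (p : Path x y) (h : y ≠ y') :
    idem ν y' * ν (ofPath k p) = 0 := by
  unfold idem
  rw [← map_mul, ofPath_mul_ofPath_of_ne _ _ _ h, map_zero]

theorem ofPath_mul_idem_of_ne {x x' y : V} (p : Path x y) (h : x' ≠ x) :
    ν (ofPath k p) * idem ν x' = 0 := by
  unfold idem
  rw [← map_mul, ofPath_mul_ofPath_of_ne _ _ _ h, map_zero]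

/-- Inner derivations by diagonal elements are exactly the coboundary weights; both halves of the
bijectivity of `theta` use this dictionary. -/
theorem inner_sum_ofPath (c : V → k) {x y : V} (p : Path x y) :
    inner k (∑ i, c i • idem ν i) (ν (ofPath k p)) = (c y - c x) • ν (ofPath k p) := by
  simp only [inner, LinearMap.sub_apply, LinearMap.mulLeft_apply, LinearMap.mulRight_apply]
  rw [Finset.sum_mul, Finset.mul_sum, Finset.sum_eq_single y, Finset.sum_eq_single x,
    smul_mul_assoc, mul_smul_comm, idem_mul_ofPath, ofPath_mul_idem, sub_smul]
  · intro i _ hi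
    rw [mul_smul_comm, ofPath_mul_idem_of_ne _ _ hi, smul_zero]
  · simp
  · intro i _ hi
    rw [smul_mul_assoc, idem_mul_ofPath_of_ne _ _ hi.symm, smul_zero]
  · simp

theorem map_arrow_ne_zero {ν : PathAlgebra k V →ₐ[k] A} (hν : IsPresentation ν) {x y : V}
    (α : x ⟶ y) : ν (ofPath k α.toPath) ≠ 0 := by
  obtain ⟨N, -, -, h⟩ := hν.admissible
  exact fun h0 => ofPath_arrow_notMem k α (h h0)

/-- A unitary derivation of a constricted algebra acts on every arrow by a scalar. -/
theorem exists_arrow_weight {ν : PathAlgebra k V →ₐ[k] A} (hν : IsPresentation ν)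
    (hA : IsConstricted ν) (d : Der₀ k (idem ν)) {x y : V} (α : x ⟶ y) :
    ∃ t : k, (d : Module.End k A) (ν (ofPath k α.toPath)) = t • ν (ofPath k α.toPath) := by
  have hd : ∀ a b, (d : Module.End k A) (a * b)
    = a * (d : Module.End k A) b + (d : Module.End k A) a * b := d.2.1
  have hm : ∀ a : A, idem ν y * a * idem ν x = a → a ∈ corner k (idem ν y) (idem ν x) :=
    fun a ha => ⟨a, by simpa [mul_assoc] using ha⟩
  set a := ν (ofPath k α.toPath) with ha
  have h1 : idem ν y * a = a := idem_mul_ofPath ν _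
  have h2 : a * idem ν x = a := ofPath_mul_idem ν _
  -- Leibniz applied to e_y a = a, with d(e_y) = 0, keeps d(a) in the corner of a; that corner is a
  -- line spanned by a ≠ 0.
  have h3 : idem ν y * (d : Module.End k A) a = (d : Module.End k A) a := by
    have := hd (idem ν y) a
    rw [d.2.2 y, zero_mul, add_zero, h1] at this
    exact this.symm
  have h4 : (d : Module.End k A) a * idem ν x = (d : Module.End k A) a := by
    have := hd a (idem ν x)
    rw [d.2.2 x, mul_zero, zero_add, h2] at this
    exact this.symm
  have hne : (⟨a, hm a (by rw [h1, h2])⟩ : corner k (idem ν y) (idem ν x)) ≠ 0 :=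
    fun h => map_arrow_ne_zero hν α (congrArg Subtype.val h)
  obtain ⟨t, ht⟩ := (finrank_eq_one_iff_of_nonzero' _ hne).1 (hA x y ⟨α⟩)
    ⟨(d : Module.End k A) a, hm _ (by rw [h3, h4])⟩
  exact ⟨t, (congrArg Subtype.val ht).symm⟩

variable {ν}

/-- By Leibniz, eigenvalues add under composition of paths, and trivial paths have eigenvalue 0
because d kills the idempotents. -/
theorem der_ofPath {d : Module.End k A} (hd : d ∈ Der₀ k (idem ν))
    {t : ∀ x y : V, (x ⟶ y) → k}
    (ht : ∀ {x y : V} (α : x ⟶ y), d (ν (ofPath k α.toPath)) = t x y α • ν (ofPath k α.toPath))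
    {x y : V} (p : Path x y) :
    d (ν (ofPath k p)) = walkWeight t (toWalk p) • ν (ofPath k p) := by
  induction p with
  | nil => exact (hd.2 x).trans (zero_smul k _).symm
  | cons p α ih =>
    rw [← Path.comp_toPath_eq_cons, ← ofPath_mul_ofPath, map_mul, hd.1, ih, ht, mul_smul_comm,
      smul_mul_assoc, ← add_smul]
    rfl

/-- If an endomorphism of `A` acts on the images of the paths by scalars, then it acts by the same
scalar on all the paths of a minimal relation. -/
theorem weight_eq_of_minimal {d : Module.End k A} {s : OPath V → k}
    (hs : ∀ p, d (ν (single k p)) = s p • ν (single k p)) {r : PathAlgebra k V}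
    (hr : IsMinimalRelation (relations ν) r) {p q : OPath V} (hp : p ∈ supp r) (hq : q ∈ supp r) :
    s p = s q := by
  classical
  obtain ⟨hrI, -, hmin⟩ := hr
  -- The paths of `r` are grouped by eigenvalue. The images of the groups lie in distinct
  -- eigenspaces and sum to ν(r) = 0, so each vanishes and each group is a subsum of `r` in Ker ν.
  let g : k → A := fun μ => ν (subsum r ((supp r).filter fun p => s p = μ))
  have hg : ∀ μ, g μ ∈ d.eigenspace μ := by
    intro μ
    simp only [g, subsum, map_sum, map_smul]
    refine Submodule.sum_mem _ fun i hi => Submodule.smul_mem _ _ ?_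
    rw [Module.End.mem_eigenspace_iff, hs, (Finset.mem_filter.1 hi).2]
  have hsum : ∑ μ ∈ (supp r).image s, g μ = 0 := by
    have h0 : ν r = 0 := hrI
    rw [eq_subsum r] at h0
    rw [← h0, ← map_sum]
    congr 1
    exact Finset.sum_fiberwise_of_maps_to (fun i hi => Finset.mem_image_of_mem s hi) _
  have hz : g (s q) = 0 :=
    ((iSupIndep_iff_finsetSum_eq_zero_imp_eq_zero _).1 d.eigenspaces_iSupIndep) _ _
      (fun μ _ => hg μ) hsum _ (Finset.mem_image_of_mem s hq)
  by_contra hpq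
  -- The group of q contains q; if the eigenvalues differed it would miss p, hence be a proper
  -- subsum forbidden by minimality.
  refine hmin ((supp r).filter fun p => s p = s q) ⟨q, Finset.mem_filter.2 ⟨hq, rfl⟩⟩
    ⟨Finset.filter_subset _ _, fun h => ?_⟩ hz
  exact hpq (Finset.mem_filter.1 (h hp)).2

/-! ### Bijectivity of `theta`. -/

theorem theta_injective {T : WideSubquiver V} (hT : IsMaximalTree T) (x₀ : Symmetrify V)
    (hν : IsPresentation ν) : Function.Injective (theta hT x₀ hν) := by
  rw [injective_iff_map_eq_zero]
  intro f hf
  have hf' : tildeLin hT x₀ hν.surjective f ∈ (Int₀ k (idem ν)).toSubmodule :=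
    (Submodule.Quotient.mk_eq_zero _).1 hf
  obtain ⟨c, hc, h⟩ := hf'
  obtain ⟨c, rfl⟩ := (Submodule.mem_span_range_iff_exists_fun k).1 hc
  -- The diagonal element gives the potential `c`; scalars can be compared on each arrow because its
  -- image in A is nonzero.
  refine f.eq_zero_of_arrows hT c fun {x y} α => ?_
  have h1 := LinearMap.congr_fun h (ν (ofPath k α.toPath))
  rw [inner_sum_ofPath] at h1
  exact smul_left_injective k (map_arrow_ne_zero hν α)
    ((tilde_ofPath hT x₀ hν.surjective f α.toPath).symm.trans h1)

theorem theta_surjective {T : WideSubquiver V} (hT : IsMaximalTree T) (x₀ : Symmetrify V)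
    (hν : IsPresentation ν) (hA : IsConstricted ν) : Function.Surjective (theta hT x₀ hν) := by
  intro D
  obtain ⟨d, rfl⟩ := Submodule.Quotient.mk_surjective _ D
  choose t ht using fun (x y : V) (α : x ⟶ y) => exists_arrow_weight hν hA d α
  have hd : ∀ {x y : V} (p : Path x y), (d : Module.End k A) (ν (ofPath k p))
      = walkWeight t (toWalk p) • ν (ofPath k p) :=
    fun p => der_ofPath d.2 (fun {x y} => ht x y) p
  have hw : ∀ {p q : Walk x₀ x₀}, Homotopic (relations ν) p q →
      walkWeight t p = walkWeight t q :=
    fun hpq => walkWeight_homotopic _ (fun r {x y} p q hr hp hq =>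
      weight_eq_of_minimal (s := fun p => walkWeight t (toWalk p.path))
        (fun p => hd p.path) hr hp hq) hpq
  refine ⟨weightCharacter _ x₀ hw, (Submodule.Quotient.eq _).2 ?_⟩
  -- On a path u from x to y, the derivation of the character minus `d` has eigenvalue w(γ_x) -
  -- w(γ_y), which is c_y - c_x for c_x = -w(γ_x).
  refine ⟨∑ x : V, (-walkWeight t (treeWalk hT x₀ x)) • idem ν x,
    Submodule.sum_mem _ fun x _ => Submodule.smul_mem _ _ (Submodule.subset_span ⟨x, rfl⟩), ?_⟩
  refine linearMap_ext_path hν.surjective fun x y u => ?_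
  rw [inner_sum_ofPath]
  change tilde hT x₀ hν.surjective _ _ - (d : Module.End k A) _ = _
  rw [tilde_ofPath, hd, ← sub_smul, weightCharacter_eval, walkWeight_treeLoop]
  congr 1
  ring

/-! ### Comparison of unitary derivations with all derivations. -/

theorem corner_le_span_idem (hacyclic : ∀ (x : V) (p : Path x x), p.length = 0)
    (hν : Function.Surjective ν) (x : V) (a : A) :
    idem ν x * a * idem ν x ∈ Submodule.span k (Set.range (idem ν)) := by
  obtain ⟨a, rfl⟩ := hν a
  induction a using path_induction with
  | zero => simp
  | add _ _ h1 h2 => rw [map_add, mul_add, add_mul]; exact Submodule.add_mem _ h1 h2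
  | smul _ _ h => rw [map_smul, mul_smul_comm, smul_mul_assoc]; exact Submodule.smul_mem _ _ h
  | path y z p =>
    by_cases hz : z = x
    · subst hz
      by_cases hy : z = y
      · subst hy
        -- Without oriented cycles, the only path from a vertex to itself is trivial.
        rw [idem_mul_ofPath, ofPath_mul_idem, Path.eq_nil_of_length_zero p (hacyclic _ p)]
        exact Submodule.subset_span ⟨z, rfl⟩
      · rw [mul_assoc, ofPath_mul_idem_of_ne _ _ hy, mul_zero]
        exact Submodule.zero_mem _
    · rw [idem_mul_ofPath_of_ne _ _ hz, zero_mul]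
      exact Submodule.zero_mem _

/-- If the inner derivation of c kills every e_x, then c commutes with them, so c = ∑ e_x c e_x, and
each summand is a multiple of e_x by acyclicity. -/
theorem toHH1_injective (hacyclic : ∀ (x : V) (p : Path x x), p.length = 0)
    (hν : Function.Surjective ν) : Function.Injective (HH1₀.toHH1 k (idem ν)) := by
  rw [injective_iff_map_eq_zero]
  intro D hD
  obtain ⟨d, rfl⟩ := Submodule.Quotient.mk_surjective _ D
  have hD' : Der₀.toDer k (idem ν) d ∈ (Inn k A).toSubmodule :=
    (Submodule.Quotient.mk_eq_zero _).1 hD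
  obtain ⟨c, hc⟩ := hD'
  have hc' : (d : Module.End k A) = inner k c := hc
  refine (Submodule.Quotient.mk_eq_zero _).2 ⟨c, ?_, hc'⟩
  have hcomm : ∀ x, c * idem ν x = idem ν x * c := by
    intro x
    have := d.2.2 x
    rw [hc'] at this
    exact sub_eq_zero.1 this
  have : c = ∑ x : V, idem ν x * c * idem ν x := by
    conv_lhs => rw [← mul_one c, ← sum_idem ν, Finset.mul_sum]
    refine Finset.sum_congr rfl fun x _ => ?_
    rw [mul_assoc, hcomm, ← mul_assoc, idem_mul_self]
  rw [this]
  exact Submodule.sum_mem _ fun x _ => corner_le_span_idem hacyclic hν x c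

theorem toHH1_surjective : Function.Surjective (HH1₀.toHH1 k (idem ν)) := by
  intro D
  obtain ⟨d, rfl⟩ := Submodule.Quotient.mk_surjective _ D
  have hd : ∀ a b, (d : Module.End k A) (a * b)
    = a * (d : Module.End k A) b + (d : Module.End k A) a * b := d.2
  -- This is the usual averaging over the separable subalgebra spanned by the e_y: it yields c e_x -
  -- e_x c = d(e_x), so subtracting the inner derivation of c from `d` makes it unitary.
  set c : A := ∑ y, (d : Module.End k A) (idem ν y) * idem ν y with hc
  have h1 : ∀ x, c * idem ν x = (d : Module.End k A) (idem ν x) * idem ν x := by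
    intro x
    rw [hc, Finset.sum_mul, Finset.sum_eq_single x]
    · rw [mul_assoc, idem_mul_self]
    · intro y _ hy
      rw [mul_assoc, idem_mul_of_ne ν hy, mul_zero]
    · simp
  have h2 : ∀ x, idem ν x * c
      = (d : Module.End k A) (idem ν x) * idem ν x - (d : Module.End k A) (idem ν x) := by
    intro x
    have h3 : ∀ y, idem ν x * (d : Module.End k A) (idem ν y)
        = (d : Module.End k A) (idem ν x * idem ν y) - (d : Module.End k A) (idem ν x) * idem ν y :=
      fun y => eq_sub_of_add_eq (hd _ _).symm
    have h4 : ∀ y, (d : Module.End k A) (idem ν x) * idem ν y * idem ν y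
        = (d : Module.End k A) (idem ν x) * idem ν y := fun y => by rw [mul_assoc, idem_mul_self]
    simp only [hc, Finset.mul_sum, ← mul_assoc, h3, sub_mul, h4, Finset.sum_sub_distrib]
    rw [← Finset.mul_sum, sum_idem, mul_one, Finset.sum_eq_single x, idem_mul_self]
    · intro y _ hy
      rw [idem_mul_of_ne ν hy.symm, map_zero, zero_mul]
    · simp
  refine ⟨Submodule.Quotient.mk ⟨(d : Module.End k A) - inner k c,
    fun a b => ?_, fun x => ?_⟩, (Submodule.Quotient.eq _).2 ⟨-c, ?_⟩⟩
  · have h3 : inner k c (a * b) = a * inner k c b + inner k c a * b := inner_mem k A c a b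
    simp only [LinearMap.sub_apply, hd, h3, mul_sub, sub_mul]
    abel
  · change (d : Module.End k A) (idem ν x) - (c * idem ν x - idem ν x * c) = 0
    rw [h1, h2]
    abel
  · change (d : Module.End k A) - inner k c - (d : Module.End k A) = _
    ext a
    simp only [inner, LinearMap.sub_apply, LinearMap.mulLeft_apply, LinearMap.mulRight_apply,
      neg_mul, mul_neg]
    abel

end Derivations

end BoundQuiver

theorem proposition2p7 {k : Type w} [Field k] [IsAlgClosed k]
    {V : Type u} [Quiver.{v} V] [Fintype V] [∀ x y : V, Finite (x ⟶ y)]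
    (hacyclic : ∀ (x : V) (p : Quiver.Path x x), p.length = 0)
    {A : Type z} [Ring A] [Algebra k A]
    (T : WideSubquiver V) (hT : BoundQuiver.IsMaximalTree T) (x₀ : Quiver.Symmetrify V)
    (ν : BoundQuiver.PathAlgebra k V →ₐ[k] A) (hν : BoundQuiver.IsPresentation ν)
    (hA : BoundQuiver.IsConstricted ν) :
    Function.Bijective (BoundQuiver.theta hT x₀ hν) ∧
      Function.Bijective (BoundQuiver.HH1₀.toHH1 k (BoundQuiver.idem ν)) ∧
      IsLieAbelian (BoundQuiver.HH1 k A) := by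
  have h1 : Function.Surjective (BoundQuiver.theta hT x₀ hν) :=
    BoundQuiver.theta_surjective hT x₀ hν hA
  have h2 : Function.Surjective (BoundQuiver.HH1₀.toHH1 k (BoundQuiver.idem ν)) :=
    BoundQuiver.toHH1_surjective
  have habel : IsLieAbelian (BoundQuiver.Characters (BoundQuiver.relations ν) x₀) :=
    ⟨fun _ _ => rfl⟩
  refine ⟨⟨BoundQuiver.theta_injective hT x₀ hν, h1⟩,
    ⟨BoundQuiver.toHH1_injective hacyclic hν.surjective, h2⟩, ?_⟩
  -- Being abelian passes to the image of a Lie algebra homomorphism, and the composite from the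
  -- characters is onto HH¹.
  have h3 : Function.Surjective
      ((BoundQuiver.HH1₀.toHH1 k (BoundQuiver.idem ν)).comp (BoundQuiver.theta hT x₀ hν)) :=
    h2.comp h1
  exact h3.isLieAbelian habel
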